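/- Let $\mathfrak o$ be a complete discrete valuation ring with maximal ideal $\mathfrak p$ and finite residue field, let $\ell\in\mathbb N$ and $\mathfrak o_\ell=\mathfrak o/\mathfrak p^\ell$. Let $R$ be a finite (not necessarily commutative) $\mathfrak o_\ell$-algebra, let $M_1,\dots,M_k$ be finite indecomposable $R$-modules, and let $\mathcal C=\langle M_1,\dots,M_k\rangle$ be the full subcategory of the category of left $R$-modules consisting of the modules isomorphic to $\bigoplus_i M_i^{a_i}$ with $a_i\in\mathbb N$. Let $\mathcal C_{+1}=\mathrm{Fun}_{\mathfrak o_\ell}(\mathcal C,\mathfrak o_\ell\text{-}\mathrm{Mod})$ be the category of $\mathfrak o_\ell$-linear functors. For $F,G\in\mathcal C_{+1}$ write $G\preccurlyeq F$ if $G$ is isomorphic to a subquotient of $F$ (a quotient of a subfunctor of $F$), and $G\prec F$ if $G\preccurlyeq F$ and $G\not\cong F$. Let $K$ be an algebraically closed field of characteristic zero and let $M\in\mathcal C$. For $F\in\mathcal C_{+1}$ let $KF(M)$ be the $K$-vector space with basis $\{u_m\mid m\in F(M)\}$, on which $g\in\mathrm{Aut}_R(M)$ acts by $u_m\mapsto u_{F(g)(m)}$.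 An irreducible representation $V$ of $\mathrm{Aut}_R(M)$ over $K$ is called $F$-typical if $\mathrm{Hom}_{\mathrm{Aut}_R(M)}(KF(M),V)\neq 0$ and $\mathrm{Hom}_{\mathrm{Aut}_R(M)}(KG(M),V)=0$ for all $G\prec F$. 1. For every irreducible representation $V$ of $\mathrm{Aut}_R(M)$ over $K$ there is a functor $F\in\mathcal C_{+1}$, unique up to isomorphism, such that $V$ is $F$-typical; this $F$ takes values in finite modules, and $V$ is $G$-typical for every $G\cong F$. 2. An irreducible representation $V$ is $F$-typical if and only if $V$ is isomorphic to a subrepresentation of $KF(M)$ and is not isomorphic to a subrepresentation of $KG(M)$ for any $G\prec F$. 3. Let $\mathrm{Rep}(\mathrm{Aut}_R(M))$ be the category of finite-dimensional representations over $K$ and $\mathrm{Rep}(\mathrm{Aut}_R(M))_F$ its full subcategory of finite direct sums of $F$-typical irreducible representations. Then $$\mathrm{Rep}(\mathrm{Aut}_R(M))=\bigoplus_{F}\mathrm{Rep}(\mathrm{Aut}_R(M))_F,$$ where $F$ runs over the isomorphism classes of objects of $\mathcal C_{+1}$. That is, every finite-dimensional representation $W$ has a unique family of subrepresentations $W_F\in\mathrm{Rep}(\mathrm{Aut}_R(M))_F$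 with $W=\bigoplus_F W_F$, and there are no non-zero homomorphisms from an object of $\mathrm{Rep}(\mathrm{Aut}_R(M))_F$ to an object of $\mathrm{Rep}(\mathrm{Aut}_R(M))_G$ when $F\not\cong G$. -/

import Mathlib

open CategoryTheory

universe v u₁ u₂ w x y

noncomputable section

namespace FunctorMorphing

section Categories

variable (A : Type u₁) [CommRing A] {R : Type u₂} [Ring R] [Algebra A R]

/-- `X` is (isomorphic to) a module of the form `⨁ᵢ Mᵢ ^ aᵢ`, with `aᵢ ∈ ℕ`. -/
def IsSumOf {k : ℕ} (Ms : Fin k → ModuleCat.{v} R) : ObjectProperty (ModuleCat.{v} R) :=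
  fun X => ∃ a : Fin k → ℕ, Nonempty (X ≃ₗ[R] ((i : Fin k) → (Fin (a i) → Ms i)))

/-- The full subcategory `𝒞 = ⟨M₁, …, M_k⟩` of the category of left `R`-modules. -/
abbrev AddSpan {k : ℕ} (Ms : Fin k → ModuleCat.{v} R) := (IsSumOf Ms).FullSubcategory

open scoped ModuleCat.Algebra in
/-- A functor `𝒞 ⥤ A-Mod` is `A`-linear if it is additive and commutes with the action of `A`
on morphisms (`A` acts on morphisms of `R`-modules through `A → R`). -/
def IsLinearFunctor {k : ℕ} (Ms : Fin k → ModuleCat.{v} R) :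
    ObjectProperty (AddSpan Ms ⥤ ModuleCat.{v} A) :=
  fun F => F.Additive ∧ F.Linear A

/-- The category `𝒞₊₁` of `A`-linear functors from `𝒞` to `A`-modules, with natural
transformations as morphisms. -/
abbrev LinFun {k : ℕ} (Ms : Fin k → ModuleCat.{v} R) := (IsLinearFunctor A Ms).FullSubcategory

end Categories

section Order

variable {A : Type u₁} [CommRing A] {R : Type u₂} [Ring R] [Algebra A R]
  {k : ℕ} {Ms : Fin k → ModuleCat.{v} R}

/-- `F ≼ G`: the functor `F` is isomorphic to a subquotient of `G`, i.e. it is a quotient of a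
subfunctor `H` of `G`. -/
def IsSubquotient (F G : LinFun A Ms) : Prop :=
  ∃ (H : LinFun A Ms) (i : H ⟶ G) (p : H ⟶ F),
    (∀ X, Function.Injective (i.hom.app X)) ∧ (∀ X, Function.Surjective (p.hom.app X))

/-- `F ≺ G`: `F ≼ G` but `F` and `G` are not isomorphic. -/
def IsProperSubquotient (F G : LinFun A Ms) : Prop :=
  IsSubquotient F G ∧ ¬ Nonempty (F ≅ G)

/-- All values of `F` are finite modules. -/
def IsFiniteValued (F : LinFun A Ms) : Prop := ∀ X : AddSpan Ms, Finite (F.obj.obj X)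

/-- An isomorphism class of objects of `𝒞₊₁`. -/
abbrev IsoClass (A : Type u₁) [CommRing A] {R : Type u₂} [Ring R] [Algebra A R]
    {k : ℕ} (Ms : Fin k → ModuleCat.{v} R) :=
  Quotient (isIsomorphicSetoid (LinFun A Ms))

end Order

section Representations

variable {A : Type u₁} [CommRing A] {R : Type u₂} [Ring R] [Algebra A R]
  {k : ℕ} {Ms : Fin k → ModuleCat.{v} R}

/-- The group `Aut_R(M)`. -/
abbrev AutGroup (M : AddSpan Ms) := M.obj ≃ₗ[R] M.obj

/-- An automorphism of `M` as a morphism of `𝒞`. -/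
def autHom (M : AddSpan Ms) (g : AutGroup M) : M ⟶ M :=
  ObjectProperty.homMk (ModuleCat.ofHom (g : M.obj →ₗ[R] M.obj))

variable (K : Type w) [Field K]

/-- The permutation representation `KF(M)` of `Aut_R(M)`: the vector space with basis the set
`F(M)`, on which `g` acts by `u_m ↦ u_{F(g)(m)}`. -/
def permRep (F : LinFun A Ms) (M : AddSpan Ms) :
    Representation K (AutGroup M) (F.obj.obj M →₀ K) where
  toFun g := Finsupp.lmapDomain K K (F.obj.map (autHom M g))
  map_one' := by
    have h : autHom M 1 = 𝟙 M := rfl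
    rw [h, F.obj.map_id]
    exact Finsupp.lmapDomain_id K K
  map_mul' g g' := by
    have h : autHom M (g * g') = autHom M g' ≫ autHom M g := rfl
    rw [h, F.obj.map_comp]
    exact Finsupp.lmapDomain_comp K K (F.obj.map (autHom M g')) (F.obj.map (autHom M g))

variable {K} {M : AddSpan Ms} {V : Type x} [AddCommGroup V] [Module K V]

/-- `V` is an irreducible representation with `Hom(KF(M), V) ≠ 0` and `Hom(KG(M), V) = 0` for
all `G ≺ F`. -/
def IsTypical (F : LinFun A Ms) (ρ : Representation K (AutGroup M) V) : Prop :=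
  ρ.IsIrreducible ∧
  (∃ f : (permRep K F M).IntertwiningMap ρ, f ≠ 0) ∧
  ∀ G : LinFun A Ms, IsProperSubquotient G F →
    ∀ f : (permRep K G M).IntertwiningMap ρ, f = 0

/-- `V` is isomorphic to a subrepresentation of `KF(M)`. -/
def Embeds (ρ : Representation K (AutGroup M) V) (F : LinFun A Ms) : Prop :=
  ∃ f : ρ.IntertwiningMap (permRep K F M), Function.Injective f

open scoped Classical in
/-- The representation `V` is the direct sum of the subrepresentations `U i`. -/
def IsDirectSumOf {ι : Type y} (ρ : Representation K (AutGroup M) V)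
    (U : ι → Subrepresentation ρ) : Prop :=
  DirectSum.IsInternal fun i => (U i).toSubmodule

/-- `V` belongs to the stratum `Rep(Aut_R(M))_F`: it is the direct sum of finitely many
`F`-typical irreducible representations. -/
def InStratum (F : LinFun A Ms) (ρ : Representation K (AutGroup M) V) : Prop :=
  ∃ (n : ℕ) (U : Fin n → Subrepresentation ρ),
    (∀ i, IsTypical F (U i).toRepresentation) ∧ IsDirectSumOf ρ U

/-- Membership in the stratum attached to an isomorphism class of functors. -/
def InStratumClass (c : IsoClass A Ms) (ρ : Representation K (AutGroup M) V) : Prop :=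
  ∃ F : LinFun A Ms, (⟦F⟧ : IsoClass A Ms) = c ∧ InStratum F ρ

end Representations

end FunctorMorphing

end

/-! The group `Aut_R(M)` is finite, so its representations over `K` are semisimple. An irreducible
`V` occurs in `KF(M)` iff there is a non-zero equivariant function `F(M) → V`. Such a function
survives on the subfunctor `Hom(M, -)/ker f` generated by a suitable `f ∈ F(M)`
(`HasHom.exists_ker`), so only quotients of `Hom(M, -)` matter.

Existence: `V` occurs in `Hom(M, -)`, since an orbit map on `Aut_R(M)` extends by zero to `End(M)`.
Among the quotients `Hom(M, -)/J` in which `V` occurs, take one with fewest elements at `M`, and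
enlarge `J` to the largest subfunctor with the same value at `M`. A subquotient in which `V` occurs
cannot be smaller at `M`, and is then the whole functor.

Uniqueness: if `V` occurs for `F` and `G`, the composite `KF(M) → V → KG(M)` is an invariant kernel
on `F(M) × G(M)`. Over the finite ring `End(M)`, generators of the same cyclic module differ by a
unit, so Möbius inversion writes the kernel as a combination of indicators of cyclic submodules, one
of which still gives a non-zero map to `V`. If `(f₀, g₀)` generates it, that map factors through
`Hom(M, -)/(ker f₀ + ker g₀)`, as in Goursat's lemma. This is a common subquotient of `F` and `G`
(`exists_common_subquotient`); by minimality, typical `F` and `G` are both isomorphic to it.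

The decomposition groups simple submodules by the class of their functor; a simple submodule of a
sum of simples is isomorphic to a summand, which gives independence and uniqueness. -/

noncomputable section

namespace FunctorMorphing

/-! ### Möbius inversion and cyclic modules over finite rings -/

section FiniteRings

open Finset

/-- A function on a finite poset vanishes if its sum over the principal ideal of every point of
its support does. -/
theorem eq_zero_of_sum_le_eq_zero {α B : Type*} [PartialOrder α] [Fintype α] [AddCommGroup B]
    [DecidableLE α] (p : α → B) (h : ∀ T, p T ≠ 0 → ∑ T' with T' ≤ T, p T' = 0) (T : α) :
    p T = 0 := by
  classical
  induction T using WellFoundedLT.induction with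
  | ind T ih =>
    by_contra hT
    have := h T hT
    rw [sum_eq_single_of_mem T (by simp)] at this
    · exact hT this
    · intro b hb hbT
      exact ih b (lt_of_le_of_ne (by simpa using hb) hbT)

variable {S : Type*} [Ring S] {N : Type*} [AddCommGroup N] [Module S N]

/-- Two generators of the same cyclic module over a finite ring differ by a unit. -/
theorem exists_units_smul_eq [Finite S] {m m' : N}
    (h : Submodule.span S {m} = Submodule.span S {m'}) : ∃ u : Sˣ, u • m = m' := by
  classical
  have := Fintype.ofFinite S
  have := Fintype.ofFinite (Submodule S S)
  obtain ⟨a, ha⟩ := Submodule.mem_span_singleton.1 (h ▸ Submodule.mem_span_singleton_self m')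
  obtain ⟨b, hb⟩ := Submodule.mem_span_singleton.1 (h ▸ Submodule.mem_span_singleton_self m)
  -- Counts the generators of the left ideal `T` that carry `m` to `n`. The aim is `q ⊤ m = q ⊤ m'`:
  -- the left side counts `1`, so some generator of `S` carries `m` to `m'`.
  let q (T : Submodule S S) (n : N) : ℤ := #{t : S | Submodule.span S {t} = T ∧ t • m = n}
  have hq (T : Submodule S S) (n : N) :
      ∑ T' with T' ≤ T, q T' n = #{t : S | t ∈ T ∧ t • m = n} := by
    rw [card_eq_sum_card_fiberwise (f := fun t => Submodule.span S {t})
      (t := {T' : Submodule S S | T' ≤ T})]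
    · push_cast
      refine sum_congr rfl fun T' hT' => ?_
      simp only [q, filter_filter]
      congr 2
      ext t
      simp only [mem_filter, mem_univ, true_and] at hT' ⊢
      constructor
      · rintro ⟨rfl, h⟩
        exact ⟨⟨hT' (Submodule.mem_span_singleton_self t), h⟩, rfl⟩
      · rintro ⟨⟨_, h⟩, h'⟩
        exact ⟨h', h⟩
    · intro t ht
      simpa using (by simpa using ht : t ∈ T ∧ t • m = n).1
  have hT (T : Submodule S S) :
      #{t : S | t ∈ T ∧ t • m = m} = #{t : S | t ∈ T ∧ t • m = m'} := by
    by_cases hex : ∃ t₀ ∈ T, t₀ • m = m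
    · obtain ⟨t₀, ht₀, h₀⟩ := hex
      -- Both sets are cosets of the annihilator of `m` in `T`; since `a * t₀` carries `m` to `m'`,
      -- translation by `a * t₀ - t₀` matches them.
      refine card_bij' (fun t _ => t - t₀ + a * t₀) (fun t _ => t - a * t₀ + t₀) ?_ ?_ ?_ ?_
      · intro t ht
        simp only [mem_filter, mem_univ, true_and] at ht ⊢
        exact ⟨T.add_mem (T.sub_mem ht.1 ht₀) (T.smul_mem a ht₀), by
          simp [add_smul, sub_smul, mul_smul, ht.2, h₀, ha]⟩
      · intro t ht
        simp only [mem_filter, mem_univ, true_and] at ht ⊢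
        exact ⟨T.add_mem (T.sub_mem ht.1 (T.smul_mem a ht₀)) ht₀, by
          simp [add_smul, sub_smul, mul_smul, ht.2, h₀, ha]⟩
      · intro t _; abel
      · intro t _; abel
    · rw [filter_false_of_mem, filter_false_of_mem]
      · rintro t - ⟨ht, h₁⟩
        exact hex ⟨b * t, T.smul_mem b ht, by rw [mul_smul, h₁, hb]⟩
      · rintro t - ⟨ht, h₁⟩
        exact hex ⟨t, ht, h₁⟩
  have key := eq_zero_of_sum_le_eq_zero (fun T => q T m - q T m') (fun T _ => by
    rw [sum_sub_distrib, hq, hq, hT, sub_self]) ⊤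
  have hpos : 0 < q ⊤ m := by
    simp only [q, Nat.cast_pos, card_pos]
    exact ⟨1, by simp⟩
  have hpos' : 0 < q ⊤ m' := by
    have : q ⊤ m - q ⊤ m' = 0 := key
    omega
  simp only [q, Nat.cast_pos, card_pos] at hpos'
  obtain ⟨t, ht⟩ := hpos'
  simp only [mem_filter, mem_univ, true_and] at ht
  -- A generator of `S` as a left ideal has a left inverse, hence is a unit because `S` is finite.
  obtain ⟨s, hs⟩ := Submodule.mem_span_singleton.1 (ht.1 ▸ Submodule.mem_top : (1 : S) ∈ _)
  obtain ⟨u, rfl⟩ : IsUnit t := IsUnit.of_mul_eq_one_right s hs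
  exact ⟨u, ht.2⟩

/-- A unit-invariant kernel with a non-zero value at `f` may be replaced by the indicator
function of a cyclic submodule. -/
theorem exists_sum_cyclic_ne_zero [Finite S] {N₁ N₂ : Type*} [AddCommGroup N₁] [AddCommGroup N₂]
    [Module S N₁] [Module S N₂] [Fintype N₁] [Fintype N₂] {K V : Type*} [Field K] [AddCommGroup V]
    [Module K V] (p : N₂ → V) (h : N₁ × N₂ → K) (hh : ∀ (u : Sˣ) z, h (u • z) = h z) (f : N₁)
    (hf : ∑ g, h (f, g) • p g ≠ 0) :
    ∃ z : N₁ × N₂, (open scoped Classical in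
      ∑ g with (f, g) ∈ Submodule.span S {z}, p g) ≠ 0 := by
  classical
  by_contra! H
  have := Fintype.ofFinite (Submodule S (N₁ × N₂))
  let q (T : Submodule S (N₁ × N₂)) : V := ∑ g with Submodule.span S {(f, g)} = T, p g
  have hq : ∀ T, q T = 0 := by
    -- `H` speaks of cyclic submodules only. This suffices, because `q T ≠ 0` forces `T` to be
    -- generated by some `(f, g)`; hence the inversion lemma asks for nothing outside the support.
    refine eq_zero_of_sum_le_eq_zero q fun T hT => ?_
    obtain ⟨g, hg, -⟩ := exists_ne_zero_of_sum_ne_zero hT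
    have hg : Submodule.span S {(f, g)} = T := by simpa using hg
    rw [← H (f, g), hg, ← sum_fiberwise_of_maps_to (g := fun g => Submodule.span S {(f, g)})
      (t := {T' : Submodule S (N₁ × N₂) | T' ≤ T})]
    · refine sum_congr rfl fun T' hT' => ?_
      simp only [q, filter_filter]
      congr 1
      ext t
      simp only [mem_filter, mem_univ, true_and] at hT' ⊢
      constructor
      · rintro rfl
        exact ⟨hT' (Submodule.mem_span_singleton_self _), rfl⟩
      · exact fun h => h.2
    · intro t ht
      simpa using ht
  apply hf
  rw [← sum_fiberwise_of_maps_to (g := fun g => Submodule.span S {(f, g)}) (t := univ)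
    (fun _ _ => mem_univ _)]
  refine sum_eq_zero fun T _ => ?_
  -- The pairs `(f, g)` generating a fixed `T` form part of one unit orbit, so `h` is constant on
  -- them and factors out of the sum.
  by_cases hT : ∃ g₀, Submodule.span S {(f, g₀)} = T
  · obtain ⟨g₀, rfl⟩ := hT
    rw [← smul_zero (h (f, g₀)), ← hq (Submodule.span S {(f, g₀)}), smul_sum]
    refine sum_congr rfl fun g hg => ?_
    obtain ⟨u, hu⟩ := exists_units_smul_eq (by simpa using hg :
      Submodule.span S {(f, g)} = Submodule.span S {(f, g₀)})
    rw [← hu, hh]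
  · exact sum_eq_zero fun g hg => (hT ⟨g, by simpa using hg⟩).elim

end FiniteRings

/-! ### Linear functors and quotients of `Hom(M, -)` -/

section Functors

open scoped ModuleCat.Algebra

variable {A : Type u₁} [CommRing A] {R : Type u₂} [Ring R] [Algebra A R]
  {k : ℕ} {Ms : Fin k → ModuleCat.{v} R}

theorem finite_of_addSpan (hfin : ∀ i, Finite (Ms i)) (X : AddSpan Ms) : Finite X.obj := by
  obtain ⟨a, ⟨e⟩⟩ := X.property
  exact Finite.of_equiv _ e.symm.toEquiv

theorem finite_hom (hfin : ∀ i, Finite (Ms i)) (X Y : AddSpan Ms) : Finite (X ⟶ Y) := by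
  have := finite_of_addSpan hfin X
  have := finite_of_addSpan hfin Y
  refine Finite.of_injective (fun f : X ⟶ Y => (f.hom : X.obj → Y.obj)) fun f g h => ?_
  ext x
  exact congrFun h x

/-- A natural transformation in `𝒞₊₁` that is bijective on all values is an isomorphism. -/
theorem nonempty_iso_of_bijective {F G : LinFun A Ms} (i : F ⟶ G)
    (h : ∀ X, Function.Bijective (i.hom.app X)) : Nonempty (F ≅ G) := by
  have (X : AddSpan Ms) : IsIso (i.hom.app X) := (ConcreteCategory.isIso_iff_bijective _).2 (h X)
  have : IsIso i.hom := NatIso.isIso_of_isIso_app _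
  exact ⟨ObjectProperty.isoMk _ (asIso i.hom)⟩

theorem map_hom_app_apply {F G : LinFun A Ms} (i : F ⟶ G) {X Y : AddSpan Ms} (b : X ⟶ Y)
    (z : F.obj.obj X) : i.hom.app Y (F.obj.map b z) = G.obj.map b (i.hom.app X z) :=
  NatTrans.naturality_apply i.hom b z

theorem map_add_apply (F : LinFun A Ms) {X Y : AddSpan Ms} (a b : X ⟶ Y) (z : F.obj.obj X) :
    F.obj.map (a + b) z = F.obj.map a z + F.obj.map b z := by
  have := F.property.1
  rw [F.obj.map_add]
  rfl

theorem map_smul_apply (F : LinFun A Ms) {X Y : AddSpan Ms} (r : A) (a : X ⟶ Y)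
    (z : F.obj.obj X) : F.obj.map (r • a) z = r • F.obj.map a z := by
  have := F.property.2
  rw [Functor.Linear.map_smul]
  rfl

theorem map_comp_apply' (F : LinFun A Ms) {X Y Z : AddSpan Ms} (a : X ⟶ Y) (b : Y ⟶ Z)
    (z : F.obj.obj X) : F.obj.map (a ≫ b) z = F.obj.map b (F.obj.map a z) := by
  simp

/-- A subfunctor of the functor `Hom(M, -)`. -/
structure HomSubfunctor (A : Type u₁) [CommRing A] {R : Type u₂} [Ring R] [Algebra A R]
    {k : ℕ} {Ms : Fin k → ModuleCat.{v} R} (M : AddSpan Ms) where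
  /-- The values of the subfunctor. -/
  carrier (X : AddSpan Ms) : Submodule A (M ⟶ X)
  comp_mem {X Y : AddSpan Ms} (b : X ⟶ Y) {a : M ⟶ X} : a ∈ carrier X → a ≫ b ∈ carrier Y

namespace HomSubfunctor

variable {M : AddSpan Ms}

/-- The quotient of `Hom(M, -)` by a subfunctor. -/
def quotient (J : HomSubfunctor A M) : LinFun A Ms where
  obj :=
    { obj X := ModuleCat.of A ((M ⟶ X) ⧸ J.carrier X)
      map {X Y} b := ModuleCat.ofHom ((J.carrier X).mapQ (J.carrier Y) (Linear.rightComp A M b)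
        fun _ h => J.comp_mem b h)
      map_id X := by
        ext z
        exact congrArg (Submodule.Quotient.mk (p := J.carrier _)) (Category.comp_id z)
      map_comp b c := by
        ext z
        exact congrArg (Submodule.Quotient.mk (p := J.carrier _)) (Category.assoc z b c).symm }
  property := by
    refine ⟨⟨fun {X Y b c} => ?_⟩, ⟨fun {X Y} b r => ?_⟩⟩
    · ext z
      exact congrArg (Submodule.Quotient.mk (p := J.carrier _)) (Preadditive.comp_add _ _ _ z b c)
    · ext z
      exact congrArg (Submodule.Quotient.mk (p := J.carrier _)) (Linear.comp_smul _ _ _ z r b)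

/-- The class of a morphism in the quotient of `Hom(M, -)`. -/
def cls (J : HomSubfunctor A M) {X : AddSpan Ms} (a : M ⟶ X) : J.quotient.obj.obj X :=
  Submodule.Quotient.mk (p := J.carrier X) a

theorem cls_surjective (J : HomSubfunctor A M) {X : AddSpan Ms} (z : J.quotient.obj.obj X) :
    ∃ a, J.cls a = z :=
  Submodule.Quotient.mk_surjective _ z

theorem map_cls (J : HomSubfunctor A M) {X Y : AddSpan Ms} (b : X ⟶ Y) (a : M ⟶ X) :
    J.quotient.obj.map b (J.cls a) = J.cls (a ≫ b) := rfl

theorem cls_eq_cls (J : HomSubfunctor A M) {X : AddSpan Ms} {a b : M ⟶ X} :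
    J.cls a = J.cls b ↔ a - b ∈ J.carrier X :=
  Submodule.Quotient.eq _

theorem cls_eq_zero (J : HomSubfunctor A M) {X : AddSpan Ms} {a : M ⟶ X} :
    J.cls a = 0 ↔ a ∈ J.carrier X :=
  Submodule.Quotient.mk_eq_zero _

theorem isFiniteValued_quotient (hfin : ∀ i, Finite (Ms i)) (J : HomSubfunctor A M) :
    IsFiniteValued J.quotient := fun X => by
  have := finite_hom hfin M X
  exact Finite.of_surjective (J.cls (X := X)) J.cls_surjective

/-- The morphism out of a quotient of `Hom(M, -)` defined by an element of `F(M)`. -/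
def desc (J : HomSubfunctor A M) (F : LinFun A Ms) (f : F.obj.obj M)
    (h : ∀ X, ∀ a ∈ J.carrier X, F.obj.map a f = 0) : J.quotient ⟶ F :=
  ObjectProperty.homMk
    { app X := ModuleCat.ofHom ((J.carrier X).liftQ
        { toFun a := F.obj.map a f
          map_add' a b := map_add_apply F a b f
          map_smul' r a := map_smul_apply F r a f } (h X))
      naturality X Y b := by
        ext z
        obtain ⟨a, rfl⟩ := J.cls_surjective z
        exact map_comp_apply' F a b f }

theorem desc_app_cls (J : HomSubfunctor A M) (F : LinFun A Ms) (f : F.obj.obj M)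
    (h : ∀ X, ∀ a ∈ J.carrier X, F.obj.map a f = 0) {X : AddSpan Ms} (a : M ⟶ X) :
    (J.desc F f h).hom.app X (J.cls a) = F.obj.map a f := rfl

/-- The kernel of the morphism `Hom(M, -) ⟶ F` defined by an element of `F(M)`. -/
def ker (F : LinFun A Ms) (f : F.obj.obj M) : HomSubfunctor A M where
  carrier X :=
    { carrier := {a | F.obj.map a f = 0}
      zero_mem' := by
        have := F.property.1
        simp
      add_mem' {a b} ha hb := by
        rw [Set.mem_ofPred_eq] at *
        rw [map_add_apply, ha, hb, add_zero]
      smul_mem' r a ha := by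
        rw [Set.mem_ofPred_eq] at *
        rw [map_smul_apply, ha, smul_zero] }
  comp_mem b a ha := by
    change F.obj.map a f = 0 at ha
    change F.obj.map (a ≫ b) f = 0
    rw [map_comp_apply', ha, map_zero]

theorem mem_ker {F : LinFun A Ms} {f : F.obj.obj M} {X : AddSpan Ms} {a : M ⟶ X} :
    a ∈ (ker F f).carrier X ↔ F.obj.map a f = 0 := Iff.rfl

/-- A quotient of `Hom(M, -)` by a subfunctor containing the annihilator of an element of `F(M)`
is a subquotient of `F`. -/
theorem isSubquotient_quotient {J : HomSubfunctor A M} {F : LinFun A Ms} (f : F.obj.obj M)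
    (h : ∀ X, ∀ a : M ⟶ X, F.obj.map a f = 0 → a ∈ J.carrier X) :
    IsSubquotient J.quotient F := by
  -- The intermediate functor is the subfunctor of `F` generated by `f`.
  refine ⟨(ker F f).quotient, (ker F f).desc F f fun X a ha => ha,
    (ker F f).desc J.quotient (J.cls (𝟙 M)) fun X a ha => ?_, fun X => ?_, fun X => ?_⟩
  · rw [map_cls, Category.id_comp, cls_eq_zero]
    exact h X a ha
  · refine (injective_iff_map_eq_zero ((ker F f).desc F f _ |>.hom.app X).hom).2 fun z hz => ?_
    obtain ⟨a, rfl⟩ := cls_surjective _ z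
    exact (cls_eq_zero _).2 hz
  · intro z
    obtain ⟨a, rfl⟩ := cls_surjective _ z
    exact ⟨(ker F f).cls a, by rw [desc_app_cls, map_cls, Category.id_comp]⟩

/-- For two annihilators `ker f` and `ker g`, dividing by their sum gives a common quotient of the
functors generated by `f` and `g`. -/
instance : Max (HomSubfunctor A M) where
  max J J' :=
    { carrier X := J.carrier X ⊔ J'.carrier X
      comp_mem b a h := by
        obtain ⟨c, hc, d, hd, rfl⟩ := Submodule.mem_sup.1 h
        rw [Preadditive.add_comp]
        exact Submodule.add_mem_sup (J.comp_mem b hc) (J'.comp_mem b hd) }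

theorem mem_sup {J J' : HomSubfunctor A M} {X : AddSpan Ms} {a : M ⟶ X} :
    a ∈ (J ⊔ J').carrier X ↔ ∃ c ∈ J.carrier X, ∃ d ∈ J'.carrier X, c + d = a :=
  Submodule.mem_sup

/-- The largest subfunctor of `Hom(M, -)` whose value at `M` is that of `J`. -/
def saturate (J : HomSubfunctor A M) : HomSubfunctor A M where
  carrier X := ⨅ b : X ⟶ M, (J.carrier M).comap (Linear.rightComp A M b)
  comp_mem {X Y} b {a} h := by
    simp only [Submodule.mem_iInf, Submodule.mem_comap, Linear.rightComp_apply,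
      Category.assoc] at h ⊢
    exact fun c => h (b ≫ c)

theorem mem_saturate {J : HomSubfunctor A M} {X : AddSpan Ms} {a : M ⟶ X} :
    a ∈ J.saturate.carrier X ↔ ∀ b : X ⟶ M, a ≫ b ∈ J.carrier M := by
  simp [saturate]

theorem le_saturate (J : HomSubfunctor A M) {X : AddSpan Ms} {a : M ⟶ X} (h : a ∈ J.carrier X) :
    a ∈ J.saturate.carrier X :=
  mem_saturate.2 fun b => J.comp_mem b h

theorem mem_saturate_self {J : HomSubfunctor A M} {a : M ⟶ M} :
    a ∈ J.saturate.carrier M ↔ a ∈ J.carrier M :=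
  ⟨fun h => by simpa using mem_saturate.1 h (𝟙 M), J.le_saturate⟩

/-- `Hom(M, -)/J`, for `J` saturated, has no proper subquotient of the same size at `M`. -/
theorem nonempty_iso_of_isSubquotient {J : HomSubfunctor A M} {G : LinFun A Ms}
    [Finite (J.saturate.quotient.obj.obj M)] (h : IsSubquotient G J.saturate.quotient)
    (hcard : Nat.card (J.saturate.quotient.obj.obj M) ≤ Nat.card (G.obj.obj M)) :
    Nonempty (G ≅ J.saturate.quotient) := by
  obtain ⟨H, i, p, hi, hp⟩ := h
  have hfin : Finite (H.obj.obj M) := Finite.of_injective _ (hi M)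
  have h₁ : Nat.card (H.obj.obj M) ≤ Nat.card (J.saturate.quotient.obj.obj M) :=
    Nat.card_le_card_of_injective _ (hi M)
  have h₂ : Nat.card (G.obj.obj M) ≤ Nat.card (H.obj.obj M) :=
    Nat.card_le_card_of_surjective _ (hp M)
  have hiM : Function.Bijective (i.hom.app M) :=
    (Nat.bijective_iff_injective_and_card _).2 ⟨hi M, by omega⟩
  have hpM : Function.Bijective (p.hom.app M) :=
    (Nat.bijective_iff_surjective_and_card _).2 ⟨hp M, by omega⟩
  -- The class of `𝟙 M` generates the quotient and lies in the image of `i`, so `i` is onto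
  -- everywhere.
  have hi' (X : AddSpan Ms) : Function.Bijective (i.hom.app X) := by
    refine ⟨hi X, fun z => ?_⟩
    obtain ⟨a, rfl⟩ := cls_surjective _ z
    obtain ⟨y, hy⟩ := hiM.2 (J.saturate.cls (𝟙 M))
    exact ⟨H.obj.map a y, by rw [map_hom_app_apply, hy, map_cls, Category.id_comp]⟩
  -- An element of the kernel of `p` dies under every morphism to `M`, as `p` is injective there. In
  -- a quotient by a saturated subfunctor only zero does so.
  have hp' (X : AddSpan Ms) : Function.Bijective (p.hom.app X) := by
    refine ⟨(injective_iff_map_eq_zero (p.hom.app X).hom).2 fun z hz => ?_, hp X⟩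
    have hz' (b : X ⟶ M) : H.obj.map b z = 0 := by
      apply hpM.1
      rw [map_hom_app_apply, map_zero]
      exact (congrArg (G.obj.map b) hz).trans (map_zero _)
    apply hi X
    rw [map_zero]
    obtain ⟨a, ha⟩ := J.saturate.cls_surjective (i.hom.app X z)
    rw [← ha, cls_eq_zero, mem_saturate]
    intro b
    rw [← mem_saturate_self, ← cls_eq_zero, ← map_cls, ha, ← map_hom_app_apply, hz', map_zero]
  obtain ⟨e⟩ := nonempty_iso_of_bijective i hi'
  obtain ⟨e'⟩ := nonempty_iso_of_bijective p hp'
  exact ⟨e'.symm.trans e⟩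

end HomSubfunctor

theorem isSubquotient_of_iso {F F' G G' : LinFun A Ms} (e : F ≅ F') (e' : G ≅ G')
    (h : IsSubquotient F G) : IsSubquotient F' G' := by
  obtain ⟨H, i, p, hi, hp⟩ := h
  have bij {F F' : LinFun A Ms} (e : F ≅ F') (X) : Function.Bijective (e.hom.hom.app X) :=
    (ConcreteCategory.isIso_iff_bijective _).1
      (((ObjectProperty.ι _).mapIso e).app X).isIso_hom
  refine ⟨H, i ≫ e'.hom, p ≫ e.hom, fun X => ?_, fun X => ?_⟩
  · simpa using (bij e' X).1.comp (hi X)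
  · simpa using (bij e X).2.comp (hp X)

end Functors

/-! ### Maschke's theorem for intertwining maps -/

section Semisimplicity

variable {K G V W : Type*} [Field K] [CharZero K] [Group G] [Finite G] [AddCommGroup V]
  [Module K V] [AddCommGroup W] [Module K W] {ρ : Representation K G V} {σ : Representation K G W}

open Representation

theorem exists_section (p : IntertwiningMap ρ σ) (hp : Function.Surjective p) :
    ∃ i : IntertwiningMap σ ρ, ∀ w, p (i w) = w := by
  have : NeZero (Nat.card G : K) := ⟨Nat.cast_ne_zero.2 Nat.card_pos.ne'⟩
  obtain ⟨i, hi⟩ := IsSemisimpleModule.lifting_property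
    (IntertwiningMap.equivLinearMapAsModule ρ σ p) hp LinearMap.id
  exact ⟨(IntertwiningMap.equivLinearMapAsModule σ ρ).symm i, fun w => LinearMap.congr_fun hi w⟩

theorem exists_retraction (i : IntertwiningMap ρ σ) (hi : Function.Injective i) :
    ∃ p : IntertwiningMap σ ρ, ∀ w, p (i w) = w := by
  have : NeZero (Nat.card G : K) := ⟨Nat.cast_ne_zero.2 Nat.card_pos.ne'⟩
  obtain ⟨p, hp⟩ := IsSemisimpleModule.extension_property
    (IntertwiningMap.equivLinearMapAsModule ρ σ i) hi LinearMap.id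
  exact ⟨(IntertwiningMap.equivLinearMapAsModule σ ρ).symm p, fun w => LinearMap.congr_fun hp w⟩

end Semisimplicity

/-! ### Existence and uniqueness of the typical functor -/

section Typical

open scoped ModuleCat.Algebra

variable {A : Type u₁} [CommRing A] {R : Type u₂} [Ring R] [Algebra A R]
  {k : ℕ} {Ms : Fin k → ModuleCat.{v} R} {K : Type w} [Field K] {M : AddSpan Ms}
  {V : Type x} [AddCommGroup V] [Module K V] {ρ : Representation K (AutGroup M) V}

theorem finite_autGroup (hfin : ∀ i, Finite (Ms i)) (M : AddSpan Ms) : Finite (AutGroup M) := by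
  have := finite_of_addSpan hfin M
  exact Finite.of_injective (fun g : AutGroup M => (g : M.obj → M.obj)) DFunLike.coe_injective

theorem autHom_injective : Function.Injective (autHom M) := fun g g' h => by
  ext z
  exact congrArg (fun a : M ⟶ M => a.hom z) h

theorem autHom_mul (g g' : AutGroup M) : autHom M (g * g') = autHom M g' ≫ autHom M g := rfl

theorem map_autHom_inv_map_autHom (F : LinFun A Ms) (g : AutGroup M) (z : F.obj.obj M) :
    F.obj.map (autHom M g⁻¹) (F.obj.map (autHom M g) z) = z := by
  rw [← map_comp_apply', ← autHom_mul, inv_mul_cancel]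
  exact ConcreteCategory.congr_hom (F.obj.map_id M) z

theorem map_autHom_bijective (F : LinFun A Ms) (g : AutGroup M) :
    Function.Bijective (F.obj.map (autHom M g)) :=
  Function.bijective_iff_has_inverse.2 ⟨F.obj.map (autHom M g⁻¹), map_autHom_inv_map_autHom F g,
    fun z => by simpa using map_autHom_inv_map_autHom F g⁻¹ z⟩

/-- Every unit of the endomorphism ring of `M` comes from an element of `Aut_R(M)`. -/
theorem exists_autHom_eq (u : (End M)ˣ) : ∃ g : AutGroup M, autHom M g = (u : End M) := by
  refine ⟨LinearEquiv.ofLinearMap (u : End M).hom.hom (u⁻¹ : (End M)ˣ).1.hom.hom ?_ ?_, rfl⟩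
  · ext z
    exact congrArg (fun a : End M => a.hom z) u.mul_inv
  · ext z
    exact congrArg (fun a : End M => a.hom z) u.inv_mul

/-- The values of a linear functor at `M` are modules over the endomorphism ring of `M`. -/
@[reducible]
def endModule (F : LinFun A Ms) (M : AddSpan Ms) : Module (End M) (F.obj.obj M) where
  smul a z := F.obj.map a z
  one_smul z := ConcreteCategory.congr_hom (F.obj.map_id M) z
  mul_smul a b z := map_comp_apply' F b a z
  smul_zero a := map_zero (F.obj.map a).hom
  smul_add a := map_add (F.obj.map a).hom
  add_smul a b z := map_add_apply F a b z
  zero_smul z := by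
    have := F.property.1
    exact ConcreteCategory.congr_hom (F.obj.map_zero M M) z

/-- `Hom(KF(M), V) ≠ 0`. -/
def HasHom (F : LinFun A Ms) (ρ : Representation K (AutGroup M) V) : Prop :=
  ∃ f : (permRep K F M).IntertwiningMap ρ, f ≠ 0

theorem isTypical_iff {F : LinFun A Ms} : IsTypical F ρ ↔ ρ.IsIrreducible ∧ HasHom F ρ ∧
    ∀ G : LinFun A Ms, IsProperSubquotient G F → ¬ HasHom G ρ := by
  simp [IsTypical, HasHom]

theorem permRep_single (F : LinFun A Ms) (g : AutGroup M) (z : F.obj.obj M) (c : K) :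
    permRep K F M g (Finsupp.single z c) = Finsupp.single (F.obj.map (autHom M g) z) c :=
  Finsupp.mapDomain_single

theorem hasHom_iff {F : LinFun A Ms} : HasHom F ρ ↔ ∃ ψ : F.obj.obj M → V,
    (∀ g z, ψ (F.obj.map (autHom M g) z) = ρ g (ψ z)) ∧ ∃ z, ψ z ≠ 0 := by
  constructor
  · rintro ⟨f, hf⟩
    refine ⟨fun z => f (Finsupp.single z 1), fun g z => ?_, ?_⟩
    · rw [← f.isIntertwining, permRep_single]
    · by_contra! h
      apply hf
      ext z
      simpa using h z
  · rintro ⟨ψ, hψ, z, hz⟩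
    refine ⟨⟨Finsupp.linearCombination K ψ, fun g => ?_⟩, fun h => hz ?_⟩
    · ext z
      simp [permRep_single, hψ]
    · have := DFunLike.congr_fun h (Finsupp.single z 1)
      simpa using this

/-- An equivariant function on `End(M)` that is invariant under translation by `J(M)` defines
a homomorphism from `K(Hom(M, -)/J)(M)`. -/
theorem hasHom_quotient {J : HomSubfunctor A M} (φ : (M ⟶ M) → V)
    (hφ : ∀ g a, φ (a ≫ autHom M g) = ρ g (φ a))
    (hJ : ∀ a b, a - b ∈ J.carrier M → φ a = φ b) (hne : ∃ a, φ a ≠ 0) : HasHom J.quotient ρ := by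
  choose r hr using J.cls_surjective (X := M)
  have hφr (a) : φ (r (J.cls a)) = φ a := hJ _ _ (J.cls_eq_cls.1 (hr _))
  refine hasHom_iff.2 ⟨fun z => φ (r z), fun g z => ?_, ?_⟩
  · obtain ⟨a, rfl⟩ := J.cls_surjective z
    beta_reduce
    rw [J.map_cls, hφr, hφr, hφ]
  · obtain ⟨a, ha⟩ := hne
    exact ⟨J.cls a, fun h => ha (hφr a ▸ h)⟩

theorem HasHom.of_hom {F G : LinFun A Ms} (e : F ⟶ G)
    (he : Function.Surjective (e.hom.app M)) (h : HasHom G ρ) : HasHom F ρ := by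
  obtain ⟨ψ, hψ, z, hz⟩ := hasHom_iff.1 h
  obtain ⟨y, rfl⟩ := he z
  exact hasHom_iff.2 ⟨fun y => ψ (e.hom.app M y), fun g y => by
    beta_reduce
    rw [map_hom_app_apply, hψ], y, hz⟩

theorem HasHom.of_iso {F G : LinFun A Ms} (e : F ≅ G) (h : HasHom F ρ) : HasHom G ρ := by
  refine h.of_hom e.inv fun z => ⟨e.hom.hom.app M z, ?_⟩
  have := congrArg (fun a => a.hom.app M) e.hom_inv_id
  exact ConcreteCategory.congr_hom this z

theorem IsTypical.of_iso {F G : LinFun A Ms} (h : IsTypical F ρ) (e : F ≅ G) :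
    IsTypical G ρ := by
  rw [isTypical_iff] at h ⊢
  refine ⟨h.1, h.2.1.of_iso e, fun H hH hHρ => h.2.2 H ⟨?_, fun ⟨e'⟩ => hH.2 ⟨e'.trans e⟩⟩ hHρ⟩
  exact isSubquotient_of_iso (Iso.refl H) e.symm hH.1

theorem IsTypical.nonempty_iso {F G : LinFun A Ms} (h : IsTypical F ρ) (hG : IsSubquotient G F)
    (hGρ : HasHom G ρ) : Nonempty (G ≅ F) := by
  by_contra hne
  exact (isTypical_iff.1 h).2.2 G ⟨hG, hne⟩ hGρ

/-- Pull the equivariant function `ψ` on `F(M)` back along `a ↦ F(a)(f)`, where `ψ f ≠ 0`; its value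
at the identity is `ψ f`. -/
theorem HasHom.exists_ker {F : LinFun A Ms} (h : HasHom F ρ) :
    ∃ f : F.obj.obj M, HasHom (HomSubfunctor.ker F f).quotient ρ := by
  obtain ⟨ψ, hψ, f, hf⟩ := hasHom_iff.1 h
  refine ⟨f, hasHom_quotient (fun a => ψ (F.obj.map a f)) (fun g a => ?_) (fun a b hab => ?_)
    ⟨𝟙 M, ?_⟩⟩
  · rw [map_comp_apply', hψ]
  · have := map_add_apply F (a - b) b f
    rw [sub_add_cancel, HomSubfunctor.mem_ker.1 hab, zero_add] at this
    rw [this]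
  · rw [ConcreteCategory.congr_hom (F.obj.map_id M) f]
    exact hf

/-- A functor for which there is a typical representation is a quotient of `Hom(M, -)`. -/
theorem IsTypical.exists_iso_quotient {F : LinFun A Ms} (h : IsTypical F ρ) :
    ∃ J : HomSubfunctor A M, Nonempty (J.quotient ≅ F) := by
  obtain ⟨f, hf⟩ := (isTypical_iff.1 h).2.1.exists_ker
  exact ⟨HomSubfunctor.ker F f, h.nonempty_iso
    (HomSubfunctor.isSubquotient_quotient f fun _ _ h => h) hf⟩

theorem IsSubquotient.card_le {F G : LinFun A Ms} (h : IsSubquotient G F) (X : AddSpan Ms)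
    [Finite (F.obj.obj X)] : Nat.card (G.obj.obj X) ≤ Nat.card (F.obj.obj X) := by
  obtain ⟨H, i, p, hi, hp⟩ := h
  have := Finite.of_injective _ (hi X)
  exact (Nat.card_le_card_of_surjective _ (hp X)).trans (Nat.card_le_card_of_injective _ (hi X))

theorem IsSubquotient.finite {F G : LinFun A Ms} (h : IsSubquotient G F) (X : AddSpan Ms)
    [Finite (F.obj.obj X)] : Finite (G.obj.obj X) := by
  obtain ⟨H, i, p, hi, hp⟩ := h
  have := Finite.of_injective _ (hi X)
  exact Finite.of_surjective _ (hp X)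

theorem IsTypical.isFiniteValued (hfin : ∀ i, Finite (Ms i)) {F : LinFun A Ms}
    (h : IsTypical F ρ) : IsFiniteValued F := fun X => by
  obtain ⟨J, ⟨e⟩⟩ := h.exists_iso_quotient
  have := J.isFiniteValued_quotient hfin X
  exact Finite.of_equiv (J.quotient.obj.obj X)
    (((ObjectProperty.ι _).mapIso e).app X).toLinearEquiv.toEquiv

variable (A) in
theorem exists_hasHom_quotient [Nontrivial V] (ρ : Representation K (AutGroup M) V) :
    ∃ J : HomSubfunctor A M, HasHom J.quotient ρ := by
  classical
  obtain ⟨v, hv⟩ := exists_ne (0 : V)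
  -- The orbit map of `v`, extended by zero. It stays equivariant because composing with an
  -- automorphism preserves the non-automorphisms.
  let φ (a : M ⟶ M) : V := if h : ∃ g, autHom M g = a then ρ h.choose v else 0
  have hφ (g : AutGroup M) : φ (autHom M g) = ρ g v := by
    have h : ∃ g', autHom M g' = autHom M g := ⟨g, rfl⟩
    simp only [φ, dif_pos h, autHom_injective h.choose_spec]
  refine ⟨⟨fun X => ⊥, fun b a h => by simp_all⟩, hasHom_quotient φ (fun g a => ?_)
    (fun a b h => by rw [sub_eq_zero.1 ((Submodule.mem_bot A).1 h)]) ⟨autHom M 1, ?_⟩⟩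
  · by_cases h : ∃ g', autHom M g' = a
    · obtain ⟨g', rfl⟩ := h
      rw [← autHom_mul, hφ, hφ, map_mul]
      rfl
    · have h' : ¬ ∃ g', autHom M g' = a ≫ autHom M g := by
        rintro ⟨g', hg'⟩
        refine h ⟨g⁻¹ * g', ?_⟩
        rw [autHom_mul, hg', Category.assoc, ← autHom_mul, inv_mul_cancel]
        exact Category.comp_id a
      simp only [φ, dif_neg h, dif_neg h', map_zero]
  · simpa [hφ] using hv

variable (A) in
/-- Every irreducible representation is typical for some functor. -/
theorem exists_isTypical (hfin : ∀ i, Finite (Ms i)) (hρ : ρ.IsIrreducible) :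
    ∃ F : LinFun A Ms, IsTypical F ρ := by
  classical
  have : Nontrivial V := by
    by_contra h
    rw [not_nontrivial_iff_subsingleton] at h
    obtain ⟨a, b, hab⟩ := hρ.toNontrivial
    exact hab (Subrepresentation.toSubmodule_injective (Subsingleton.elim _ _))
  have hex : ∃ n, ∃ J : HomSubfunctor A M,
      HasHom J.quotient ρ ∧ Nat.card (J.quotient.obj.obj M) = n := by
    obtain ⟨J, hJ⟩ := exists_hasHom_quotient A ρ
    exact ⟨_, J, hJ, rfl⟩
  obtain ⟨J, hJ, hn⟩ := Nat.find_spec hex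
  have hfinJ (J : HomSubfunctor A M) : Finite (J.quotient.obj.obj M) :=
    J.isFiniteValued_quotient hfin M
  have hle : IsSubquotient J.saturate.quotient J.quotient :=
    HomSubfunctor.isSubquotient_quotient (J.cls (𝟙 M)) fun X a h => J.le_saturate <| by
      rwa [J.map_cls, Category.id_comp, J.cls_eq_zero] at h
  refine ⟨J.saturate.quotient, isTypical_iff.2 ⟨hρ, ?_, fun G hG hGρ => hG.2 ?_⟩⟩
  · obtain ⟨ψ, hψ, z, hz⟩ := hasHom_iff.1 hJ
    obtain ⟨a, rfl⟩ := J.cls_surjective z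
    refine hasHom_quotient (fun a => ψ (J.cls a)) (fun g a => ?_) (fun a b hab => ?_) ⟨a, hz⟩
    · rw [← J.map_cls, hψ]
    · rw [J.cls_eq_cls.2 (HomSubfunctor.mem_saturate_self.1 hab)]
  -- `V` occurs in a cyclic subfunctor of `G`, itself a quotient of `Hom(M, -)`, so minimality of
  -- `J` bounds the size of `G(M)` from below.
  · refine HomSubfunctor.nonempty_iso_of_isSubquotient hG.1 ?_
    have := hG.1.finite M
    obtain ⟨g, hg⟩ := hGρ.exists_ker
    calc _ ≤ Nat.card (J.quotient.obj.obj M) := hle.card_le M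
      _ ≤ Nat.card ((HomSubfunctor.ker G g).quotient.obj.obj M) :=
        hn ▸ Nat.find_min' hex ⟨_, hg, rfl⟩
      _ ≤ _ := (HomSubfunctor.isSubquotient_quotient (J := HomSubfunctor.ker G g) g
        fun _ _ h => h).card_le M

attribute [local instance] endModule in
/-- Homomorphisms from `KF(M)` and `KG(M)` to an irreducible representation come from a common
subquotient of `F` and `G`. -/
theorem exists_common_subquotient [CharZero K] (hfin : ∀ i, Finite (Ms i)) (hρ : ρ.IsIrreducible)
    {F G : LinFun A Ms} [Finite (F.obj.obj M)] [Finite (G.obj.obj M)] (hF : HasHom F ρ)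
    (hG : HasHom G ρ) :
    ∃ Q : LinFun A Ms, IsSubquotient Q F ∧ IsSubquotient Q G ∧ HasHom Q ρ := by
  classical
  have := finite_autGroup hfin M
  have : Finite (End M) := finite_hom hfin M M
  have := Fintype.ofFinite (F.obj.obj M)
  have := Fintype.ofFinite (G.obj.obj M)
  obtain ⟨E, hE, f₁, hf₁⟩ := hasHom_iff.1 hF
  obtain ⟨p, hp⟩ := hG
  obtain ⟨i, hi⟩ := exists_section p
    ((Representation.IsIrreducible.surjective_or_eq_zero p).resolve_right hp)
  -- The matrix of `KF(M) → V → KG(M)`. Composing it with `p` recovers `E`, because `i` is a section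
  -- of `p`.
  let h (z : F.obj.obj M × G.obj.obj M) : K := i (E z.1) z.2
  have hh (u : (End M)ˣ) (z) : h (u • z) = h z := by
    obtain ⟨g, hg⟩ := exists_autHom_eq u
    change i (E (F.obj.map (u : End M) z.1)) (G.obj.map (u : End M) z.2) = _
    rw [← hg, hE, i.isIntertwining]
    exact Finsupp.mapDomain_apply (map_autHom_bijective G g).1 _ _
  let P (y : G.obj.obj M) : V := p (Finsupp.single y 1)
  have hP (g : AutGroup M) (y) : P (G.obj.map (autHom M g) y) = ρ g (P y) := by
    rw [← p.isIntertwining, permRep_single]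
  obtain ⟨⟨f₀, g₀⟩, hz⟩ := exists_sum_cyclic_ne_zero (S := End M) P h hh f₁ <| by
    have : ∑ y, h (f₁, y) • P y = p (i (E f₁)) := by
      conv_rhs => rw [← Finsupp.univ_sum_single (i (E f₁)), map_sum]
      refine Finset.sum_congr rfl fun y _ => ?_
      rw [← map_smul, Finsupp.smul_single, smul_eq_mul, mul_one]
    rwa [this, hi]
  set N := Submodule.span (End M) {(f₀, g₀)}
  let T (f : F.obj.obj M) : V := ∑ g with (f, g) ∈ N, P g
  obtain ⟨y, hy, -⟩ := Finset.exists_ne_zero_of_sum_ne_zero hz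
  obtain ⟨a, ha⟩ := Submodule.mem_span_singleton.1
    (by simpa using hy : (f₁, y) ∈ Submodule.span (End M) {(f₀, g₀)})
  have hmap (g : AutGroup M) {f : F.obj.obj M} {y : G.obj.obj M} (hfy : (f, y) ∈ N) :
      (F.obj.map (autHom M g) f, G.obj.map (autHom M g) y) ∈ N :=
    N.smul_mem (autHom M g : End M) hfy
  refine ⟨(HomSubfunctor.ker F f₀ ⊔ HomSubfunctor.ker G g₀).quotient,
    HomSubfunctor.isSubquotient_quotient f₀ fun X a h => Submodule.mem_sup_left h,
    HomSubfunctor.isSubquotient_quotient g₀ fun X a h => Submodule.mem_sup_right h,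
    hasHom_quotient (fun a => T (F.obj.map a f₀)) (fun g a => ?_) (fun a b hab => ?_) ⟨a, ?_⟩⟩
  · rw [map_comp_apply', map_sum]
    symm
    refine Finset.sum_bij (fun y _ => G.obj.map (autHom M g) y) (fun y hy => ?_)
      (fun y _ y' _ h => (map_autHom_bijective G g).1 h) (fun y hy => ?_) (fun y _ => (hP g y).symm)
    · simp only [Finset.mem_filter, Finset.mem_univ, true_and] at hy ⊢
      exact hmap g hy
    · obtain ⟨y, rfl⟩ := (map_autHom_bijective G g).2 y
      refine ⟨y, ?_, rfl⟩
      simp only [Finset.mem_filter, Finset.mem_univ, true_and] at hy ⊢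
      have := hmap g⁻¹ hy
      rwa [map_autHom_inv_map_autHom, map_autHom_inv_map_autHom] at this
  · obtain ⟨c, hc, d, hd, hcd⟩ := HomSubfunctor.mem_sup.1 hab
    -- As `d` kills `g₀`, translating the first coordinate by `F(d)(f₀)` preserves `N`, so the fibre
    -- over which `T` sums does not change.
    have hd' : (F.obj.map d f₀, (0 : G.obj.obj M)) ∈ N :=
      Submodule.mem_span_singleton.2 ⟨(d : End M), Prod.ext rfl hd⟩
    have hFa : F.obj.map a f₀ = F.obj.map b f₀ + F.obj.map d f₀ := by
      have hsum : a = b + (c + d) := by rw [hcd, add_sub_cancel]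
      rw [hsum, map_add_apply, map_add_apply, HomSubfunctor.mem_ker.1 hc, zero_add]
    refine Finset.sum_congr (Finset.filter_congr fun y _ => ?_) fun _ _ => rfl
    rw [hFa, ← N.add_mem_iff_left (x := (F.obj.map b f₀, y)) hd', Prod.mk_add_mk, add_zero]
  · have : F.obj.map a f₀ = f₁ := congrArg Prod.fst ha
    rwa [this]

/-- The functor for which an irreducible representation is typical is unique. -/
theorem IsTypical.nonempty_iso_of_isTypical [CharZero K] (hfin : ∀ i, Finite (Ms i))
    {F G : LinFun A Ms} (hF : IsTypical F ρ) (hG : IsTypical G ρ) : Nonempty (F ≅ G) := by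
  have := hF.isFiniteValued hfin M
  have := hG.isFiniteValued hfin M
  obtain ⟨Q, hQF, hQG, hQ⟩ := exists_common_subquotient hfin hF.1 hF.2.1 hG.2.1
  obtain ⟨e⟩ := hF.nonempty_iso hQF hQ
  obtain ⟨e'⟩ := hG.nonempty_iso hQG hQ
  exact ⟨e.symm.trans e'⟩

theorem hasHom_iff_embeds [CharZero K] (hfin : ∀ i, Finite (Ms i)) (hρ : ρ.IsIrreducible)
    {F : LinFun A Ms} : HasHom F ρ ↔ Embeds ρ F := by
  have := finite_autGroup hfin M
  constructor
  · rintro ⟨p, hp⟩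
    obtain ⟨i, hi⟩ := exists_section p
      ((Representation.IsIrreducible.surjective_or_eq_zero p).resolve_right hp)
    exact ⟨i, Function.LeftInverse.injective hi⟩
  · rintro ⟨i, hi⟩
    obtain ⟨p, hp⟩ := exists_retraction i hi
    refine ⟨p, ?_⟩
    rintro rfl
    obtain ⟨a, b, hab⟩ := hρ.toNontrivial
    have (v : V) : v = 0 := (hp v).symm
    refine hab (Subrepresentation.toSubmodule_injective (Submodule.ext fun v => ?_))
    rw [this v]
    simp

end Typical

/-! ### Subrepresentations as submodules over the group algebra -/

section Submodules

open Representation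
open scoped MonoidAlgebra

variable {K G V : Type*} [Field K] [Group G] [AddCommGroup V] [Module K V]
  {ρ : Representation K G V}

/-- A subrepresentation and the corresponding submodule over the group algebra agree. -/
def asModuleEquivAsSubmodule (W : Subrepresentation ρ) :
    W.toRepresentation.asModule ≃ₗ[K[G]] W.asSubmodule :=
  LinearEquiv.ofBijective ((IntertwiningMap.equivLinearMapAsModule W.toRepresentation ρ
      ⟨W.toSubmodule.subtype, fun _ => rfl⟩).codRestrict W.asSubmodule fun z => z.2)
    ⟨fun _ _ h => Subtype.ext (congrArg Subtype.val h), fun z => ⟨⟨z.1, z.2⟩, rfl⟩⟩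

/-- The representation on a submodule over the group algebra. -/
abbrev subRep (N : Submodule K[G] ρ.asModule) :
    Representation K G (Subrepresentation.ofSubmodule' N).toSubmodule :=
  (Subrepresentation.ofSubmodule' N).toRepresentation

/-- A submodule over the group algebra as the module of a representation. -/
def asModuleSubRepEquiv (N : Submodule K[G] ρ.asModule) : (subRep N).asModule ≃ₗ[K[G]] N :=
  asModuleEquivAsSubmodule (Subrepresentation.ofSubmodule' N)

theorem isIrreducible_subRep_iff (N : Submodule K[G] ρ.asModule) :
    (subRep N).IsIrreducible ↔ IsSimpleModule K[G] N := by
  rw [irreducible_iff_isSimpleModule_asModule]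
  exact (asModuleSubRepEquiv N).isSimpleModule_iff

end Submodules

/-- Two families of independent elements of a modular lattice, one below the other, agree if the
smaller one has supremum `⊤`. -/
theorem eq_of_le_of_iSupIndep {α ι : Type*} [CompleteLattice α] [IsModularLattice α]
    {U U' : ι → α} (hle : ∀ i, U' i ≤ U i) (hU : iSupIndep U) (hU' : ⨆ i, U' i = ⊤) : U' = U := by
  funext i
  refine (hle i).antisymm ?_
  have h : U' i ⊔ ⨆ (j) (_ : j ≠ i), U' j = ⊤ := by
    rw [eq_top_iff, ← hU']
    refine iSup_le fun j => ?_
    by_cases hj : j = i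
    · exact hj ▸ le_sup_left
    · exact le_sup_of_le_right (le_iSup₂_of_le j hj le_rfl)
  calc U i = (U' i ⊔ ⨆ (j) (_ : j ≠ i), U' j) ⊓ U i := by rw [h, top_inf_eq]
    _ = U' i ⊔ (⨆ (j) (_ : j ≠ i), U' j) ⊓ U i := sup_inf_assoc_of_le _ (hle i)
    _ ≤ U' i ⊔ (⨆ (j) (_ : j ≠ i), U j) ⊓ U i := by
      gcongr with j hj
      exact hle j
    _ = U' i := by rw [inf_comm, (hU i).eq_bot, sup_bot_eq]

/-! ### Decomposition of representations into strata -/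

section Strata

open Representation
open scoped MonoidAlgebra

variable {A : Type u₁} [CommRing A] {R : Type u₂} [Ring R] [Algebra A R]
  {k : ℕ} {Ms : Fin k → ModuleCat.{v} R} {K : Type w} [Field K] {M : AddSpan Ms}
  {V : Type x} [AddCommGroup V] [Module K V] {ρ : Representation K (AutGroup M) V}
  {V' : Type y} [AddCommGroup V'] [Module K V'] {ρ' : Representation K (AutGroup M) V'}

theorem HasHom.of_equiv {F : LinFun A Ms} (e : ρ.asModule ≃ₗ[K[AutGroup M]] ρ'.asModule)
    (h : HasHom F ρ) : HasHom F ρ' := by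
  obtain ⟨f, hf⟩ := h
  refine ⟨((IntertwiningMap.equivLinearMapAsModule ρ ρ').symm e.toLinearMap).comp f,
    fun h0 => hf ?_⟩
  ext z
  exact e.injective ((DFunLike.congr_fun h0 _).trans (map_zero e).symm)

theorem IsTypical.of_equiv {F : LinFun A Ms} (e : ρ.asModule ≃ₗ[K[AutGroup M]] ρ'.asModule)
    (h : IsTypical F ρ) : IsTypical F ρ' := by
  rw [isTypical_iff] at h ⊢
  refine ⟨?_, h.2.1.of_equiv e, fun G hG hGρ => h.2.2 G hG (hGρ.of_equiv e.symm)⟩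
  rw [irreducible_iff_isSimpleModule_asModule, ← e.isSimpleModule_iff,
    ← irreducible_iff_isSimpleModule_asModule]
  exact h.1

/-- `ρ` is typical for the functors in an isomorphism class. -/
def IsTypicalClass (c : IsoClass A Ms) (ρ : Representation K (AutGroup M) V) : Prop :=
  ∃ F : LinFun A Ms, (⟦F⟧ : IsoClass A Ms) = c ∧ IsTypical F ρ

theorem IsTypicalClass.of_equiv {c : IsoClass A Ms}
    (e : ρ.asModule ≃ₗ[K[AutGroup M]] ρ'.asModule) (h : IsTypicalClass c ρ) :
    IsTypicalClass c ρ' := by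
  obtain ⟨F, hF, h⟩ := h
  exact ⟨F, hF, h.of_equiv e⟩

theorem IsTypicalClass.isTypical {F : LinFun A Ms} (h : IsTypicalClass (⟦F⟧ : IsoClass A Ms) ρ) :
    IsTypical F ρ := by
  obtain ⟨G, hG, h⟩ := h
  obtain ⟨e⟩ := Quotient.exact hG
  exact h.of_iso e

theorem IsTypicalClass.eq [CharZero K] (hfin : ∀ i, Finite (Ms i)) {c c' : IsoClass A Ms}
    (h : IsTypicalClass c ρ) (h' : IsTypicalClass c' ρ) : c = c' := by
  obtain ⟨F, rfl, h⟩ := h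
  obtain ⟨F', rfl, h'⟩ := h'
  exact Quotient.sound (h.nonempty_iso_of_isTypical hfin h')

variable (A) in
theorem exists_isTypicalClass (hfin : ∀ i, Finite (Ms i)) (h : ρ.IsIrreducible) :
    ∃ c : IsoClass A Ms, IsTypicalClass c ρ := by
  obtain ⟨F, hF⟩ := exists_isTypical A hfin h
  exact ⟨_, F, rfl, hF⟩

theorem isDirectSumOf_iff {ι : Type*} {U : ι → Subrepresentation ρ} :
    IsDirectSumOf ρ U ↔ iSupIndep (fun i => (U i).asSubmodule) ∧
      ⨆ i, (U i).asSubmodule = ⊤ := by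
  classical
  rw [← DirectSum.isInternal_submodule_iff_iSupIndep_and_iSup_eq_top]
  unfold IsDirectSumOf
  exact Iff.rfl

variable {N : Submodule K[AutGroup M] ρ.asModule} {N' : Submodule K[AutGroup M] ρ'.asModule}

theorem IsTypicalClass.subRep_of_equiv {c : IsoClass A Ms} (e : N ≃ₗ[K[AutGroup M]] N')
    (h : IsTypicalClass c (subRep N)) : IsTypicalClass c (subRep N') :=
  h.of_equiv ((asModuleSubRepEquiv N).trans (e.trans (asModuleSubRepEquiv N').symm))

theorem IsTypicalClass.isSimpleModule {c : IsoClass A Ms} (h : IsTypicalClass c (subRep N)) :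
    IsSimpleModule K[AutGroup M] N := by
  obtain ⟨F, -, h⟩ := h
  exact (isIrreducible_subRep_iff N).1 h.1

/-- A simple submodule of a sum of typical submodules is typical for one of the same classes. -/
theorem exists_isTypicalClass_of_le_sSup {s : Set (Submodule K[AutGroup M] ρ.asModule)}
    {C : Set (IsoClass A Ms)} (hs : ∀ N ∈ s, ∃ c ∈ C, IsTypicalClass c (subRep N))
    [IsSimpleModule K[AutGroup M] N] (h : N ≤ sSup s) : ∃ c ∈ C, IsTypicalClass c (subRep N) := by
  have (m : s) : IsSimpleModule K[AutGroup M] m := by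
    obtain ⟨c, -, hc⟩ := hs m m.2
    exact hc.isSimpleModule
  obtain ⟨N', hN', ⟨e⟩⟩ := N.linearEquiv_of_le_sSup s h
  obtain ⟨c, hc, hc'⟩ := hs N' hN'
  exact ⟨c, hc, hc'.subRep_of_equiv e.symm⟩

theorem InStratumClass.isTypicalClass {c : IsoClass A Ms} (h : InStratumClass c ρ)
    [IsSimpleModule K[AutGroup M] N] : IsTypicalClass c (subRep N) := by
  obtain ⟨F, hF, n, U, hU, hsum⟩ := h
  obtain ⟨c', hc', h⟩ := exists_isTypicalClass_of_le_sSup (C := {c}) (N := N)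
    (s := Set.range fun i => (U i).asSubmodule)
    (by rintro _ ⟨i, rfl⟩; exact ⟨c, rfl, F, hF, hU i⟩)
    (by rw [sSup_range, (isDirectSumOf_iff.1 hsum).2]; exact le_top)
  obtain rfl : c' = c := hc'
  exact h

variable (ρ) in
/-- The sum of all irreducible subrepresentations that are typical for the class `c`. -/
def typicalPart (c : IsoClass A Ms) : Submodule K[AutGroup M] ρ.asModule :=
  sSup {N | IsTypicalClass c (subRep N)}

theorem isTypicalClass_of_le_typicalPart {c : IsoClass A Ms} [IsSimpleModule K[AutGroup M] N]
    (h : N ≤ typicalPart ρ c) : IsTypicalClass c (subRep N) := by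
  obtain ⟨_, rfl, h'⟩ := exists_isTypicalClass_of_le_sSup (C := {c}) (fun N hN => ⟨c, rfl, hN⟩) h
  exact h'

variable [CharZero K]

theorem isSemisimpleModule_asModule (hfin : ∀ i, Finite (Ms i)) :
    IsSemisimpleModule K[AutGroup M] ρ.asModule := by
  have := finite_autGroup hfin M
  have : NeZero (Nat.card (AutGroup M) : K) := ⟨Nat.cast_ne_zero.2 Nat.card_pos.ne'⟩
  infer_instance

/-- By semisimplicity the module is an independent sum of simple submodules, finite in number
because the dimension is finite. -/
theorem inStratumClass_of_forall (hfin : ∀ i, Finite (Ms i)) [FiniteDimensional K V]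
    {c : IsoClass A Ms} (h : ∀ N : Submodule K[AutGroup M] ρ.asModule,
      IsSimpleModule K[AutGroup M] N → IsTypicalClass c (subRep N)) : InStratumClass c ρ := by
  have := isSemisimpleModule_asModule (ρ := ρ) hfin
  have : Module.Finite K ρ.asModule := inferInstanceAs (Module.Finite K V)
  have : Module.Finite K[AutGroup M] ρ.asModule := Module.Finite.of_restrictScalars_finite K _ _
  obtain ⟨s, hs, hs', hsimple⟩ :=
    IsSemisimpleModule.exists_sSupIndep_sSup_simples_eq_top K[AutGroup M] ρ.asModule
  have hind : iSupIndep ((↑) : s → Submodule K[AutGroup M] ρ.asModule) := (sSupIndep_iff _).1 hs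
  have : Finite s := by
    have (N : s) : IsSimpleModule K[AutGroup M] N.1 := hsimple N.1 N.2
    exact WellFoundedGT.finite_of_iSupIndep hind fun N hN => by
      have := IsSimpleModule.nontrivial K[AutGroup M] N.1
      exact (Submodule.nontrivial_iff_ne_bot.1 this) hN
  obtain ⟨n, ⟨e⟩⟩ := Finite.exists_equiv_fin s
  induction c using Quotient.ind with | _ F => ?_
  refine ⟨F, rfl, n, fun i => Subrepresentation.ofSubmodule' (e.symm i).1, fun i =>
    (h _ (hsimple _ (e.symm i).2)).isTypical, isDirectSumOf_iff.2 ⟨?_, ?_⟩⟩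
  · exact hind.comp e.symm.injective
  · rw [← hs', sSup_eq_iSup']
    exact e.symm.iSup_comp (g := fun N : s => N.1)

/-- There are no non-zero morphisms between different strata. -/
theorem intertwiningMap_eq_zero (hfin : ∀ i, Finite (Ms i)) {c c' : IsoClass A Ms} (hcc : c ≠ c')
    (h : InStratumClass c ρ) (h' : InStratumClass c' ρ') (f : ρ.IntertwiningMap ρ') : f = 0 := by
  have := isSemisimpleModule_asModule (ρ := ρ) hfin
  set φ := IntertwiningMap.equivLinearMapAsModule ρ ρ' f with hφ
  suffices hker : LinearMap.ker φ = ⊤ by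
    rw [LinearMap.ker_eq_top, hφ, LinearEquiv.map_eq_zero_iff] at hker
    exact hker
  rw [eq_top_iff, ← IsSemisimpleModule.sSup_simples_eq_top K[AutGroup M] ρ.asModule]
  refine sSup_le fun N (hN : IsSimpleModule _ N) => ?_
  -- By Schur's lemma `N` is killed or embedded; an embedded `N` would be typical for both classes.
  rcases LinearMap.injective_or_eq_zero (φ.domRestrict N) with hinj | hzero
  · let e := LinearEquiv.ofInjective _ hinj
    have :=
      IsSimpleModule.congr (N := N) e.symm
    exact (hcc ((h.isTypicalClass (N := N)).eq hfin
      (h'.isTypicalClass.subRep_of_equiv e.symm))).elim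
  · exact fun z hz => LinearMap.congr_fun hzero ⟨z, hz⟩

/-- A non-zero intersection of one part with the sum of the others would contain a simple submodule
typical for two different classes. -/
theorem iSupIndep_typicalPart (hfin : ∀ i, Finite (Ms i)) :
    iSupIndep (typicalPart ρ : IsoClass A Ms → _) := by
  have := isSemisimpleModule_asModule (ρ := ρ) hfin
  intro c
  rw [disjoint_iff]
  by_contra hne
  obtain ⟨N, hN, hle⟩ := (eq_bot_or_exists_atom_le _).resolve_left hne
  have : IsSimpleModule K[AutGroup M] N := isSimpleModule_iff_isAtom.2 hN
  have h₁ := isTypicalClass_of_le_typicalPart (hle.trans inf_le_left)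
  obtain ⟨c', hc', h₂⟩ := exists_isTypicalClass_of_le_sSup (N := N) (C := {c' | c' ≠ c})
    (s := {N | ∃ c', c' ≠ c ∧ IsTypicalClass c' (subRep N)}) (fun N hN => hN)
    ((hle.trans inf_le_right).trans (iSup₂_le fun c' hc' => sSup_le_sSup fun N hN => ⟨c', hc', hN⟩))
  exact hc' (h₂.eq hfin h₁)

theorem iSup_typicalPart (hfin : ∀ i, Finite (Ms i)) :
    ⨆ c : IsoClass A Ms, typicalPart ρ c = ⊤ := by
  have := isSemisimpleModule_asModule (ρ := ρ) hfin
  rw [eq_top_iff, ← IsSemisimpleModule.sSup_simples_eq_top K[AutGroup M] ρ.asModule]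
  refine sSup_le fun N (hN : IsSimpleModule _ N) => ?_
  obtain ⟨c, hc⟩ := exists_isTypicalClass A hfin ((isIrreducible_subRep_iff N).2 hN)
  have hle : N ≤ typicalPart ρ c := le_sSup hc
  exact hle.trans (le_iSup (typicalPart ρ) c)

/-- The largest subrepresentation in the stratum of `c` is the typical part. -/
theorem inStratumClass_toRepresentation_iff (hfin : ∀ i, Finite (Ms i)) [FiniteDimensional K V]
    {c : IsoClass A Ms} {W : Subrepresentation ρ} :
    InStratumClass c W.toRepresentation ↔ W.asSubmodule ≤ typicalPart ρ c := by
  have := isSemisimpleModule_asModule (ρ := ρ) hfin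
  let φ := W.asSubmodule.subtype ∘ₗ (asModuleEquivAsSubmodule W).toLinearMap
  have hφ : Function.Injective φ :=
    W.asSubmodule.subtype_injective.comp (asModuleEquivAsSubmodule W).injective
  constructor
  · intro h
    rw [← IsSemisimpleModule.sSup_simples_le W.asSubmodule]
    refine sSup_le fun N ⟨hN, hle⟩ => le_sSup ?_
    have hrange : N ≤ LinearMap.range φ := by
      rw [LinearMap.range_comp, LinearEquiv.range, Submodule.map_top, Submodule.range_subtype]
      exact hle
    have e : N.comap φ ≃ₗ[K[AutGroup M]] N :=
      (Submodule.equivMapOfInjective φ hφ _).trans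
        (LinearEquiv.ofEq _ _ (Submodule.map_comap_eq_self hrange))
    have : IsSimpleModule K[AutGroup M] (N.comap φ) := IsSimpleModule.congr e
    exact (h.isTypicalClass (N := N.comap φ)).subRep_of_equiv e
  · intro h
    refine inStratumClass_of_forall hfin fun N hN => ?_
    have e := Submodule.equivMapOfInjective φ hφ N
    have : IsSimpleModule K[AutGroup M] (N.map φ) :=
      IsSimpleModule.congr (N := N) e.symm
    refine (isTypicalClass_of_le_typicalPart (N := N.map φ) (le_trans ?_ h)).subRep_of_equiv e.symm
    rintro _ ⟨z, -, rfl⟩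
    exact ((asModuleEquivAsSubmodule W) z).2

/-- Every finite-dimensional representation decomposes uniquely along the strata. -/
theorem existsUnique_decomposition (hfin : ∀ i, Finite (Ms i)) [FiniteDimensional K V] :
    ∃! U : IsoClass A Ms → Subrepresentation ρ,
      (∀ c, InStratumClass c (U c).toRepresentation) ∧ IsDirectSumOf ρ U := by
  refine ⟨fun c => Subrepresentation.ofSubmodule' (typicalPart ρ c), ⟨fun c => ?_, ?_⟩, ?_⟩
  · exact (inStratumClass_toRepresentation_iff hfin).2 le_rfl
  · exact isDirectSumOf_iff.2 ⟨iSupIndep_typicalPart hfin, iSup_typicalPart hfin⟩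
  · rintro U ⟨hU, hsum⟩
    -- Each piece of any decomposition lies in the corresponding typical part; since the pieces
    -- already span and the typical parts are independent, the inclusions are equalities.
    have := eq_of_le_of_iSupIndep (fun c => (inStratumClass_toRepresentation_iff hfin).1 (hU c))
      (iSupIndep_typicalPart hfin) (isDirectSumOf_iff.1 hsum).2
    funext c
    exact Subrepresentation.subrepresentationSubmoduleOrderIso.injective (congrFun this c)

end Strata

end FunctorMorphing

end

open FunctorMorphing in
/-- Let `𝔬` be a complete discrete valuation ring with finite residue field, `R` a finite
`𝔬/𝔭^ℓ`-algebra, `𝒞 = ⟨M₁, …, M_k⟩` for finite indecomposable `R`-modules `Mᵢ`, `M ∈ 𝒞`, and `K` an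
algebraically closed field of characteristic zero. -/
theorem theoremA {𝔬 : Type u₁} [CommRing 𝔬] [IsDomain 𝔬] [IsDiscreteValuationRing 𝔬]
    [IsAdicComplete (IsLocalRing.maximalIdeal 𝔬) 𝔬] [Finite (IsLocalRing.ResidueField 𝔬)] (ℓ : ℕ)
    {R : Type u₂} [Ring R] [Algebra (𝔬 ⧸ IsLocalRing.maximalIdeal 𝔬 ^ ℓ) R] [Finite R]
    {k : ℕ} (Ms : Fin k → ModuleCat.{v} R) (hfin : ∀ i, Finite (Ms i))
    (hind : ∀ i, CategoryTheory.Indecomposable (Ms i))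
    (M : AddSpan Ms) {K : Type w} [Field K] [IsAlgClosed K] [CharZero K] :
    -- Every irreducible `V` is `F`-typical for a (finite-valued) functor `F`, unique up to
    -- isomorphism.
    (∀ {V : Type x} [AddCommGroup V] [Module K V] (ρ : Representation K (AutGroup M) V),
      ρ.IsIrreducible →
        ∃ F : LinFun (𝔬 ⧸ IsLocalRing.maximalIdeal 𝔬 ^ ℓ) Ms, IsFiniteValued F ∧
          ∀ G : LinFun (𝔬 ⧸ IsLocalRing.maximalIdeal 𝔬 ^ ℓ) Ms,
            IsTypical G ρ ↔ Nonempty (G ≅ F)) ∧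
    -- Typicality can equally be tested on subrepresentations.
    (∀ {V : Type x} [AddCommGroup V] [Module K V] (ρ : Representation K (AutGroup M) V),
      ρ.IsIrreducible → ∀ F : LinFun (𝔬 ⧸ IsLocalRing.maximalIdeal 𝔬 ^ ℓ) Ms,
        (IsTypical F ρ ↔ Embeds ρ F ∧
          ∀ G : LinFun (𝔬 ⧸ IsLocalRing.maximalIdeal 𝔬 ^ ℓ) Ms,
            IsProperSubquotient G F → ¬ Embeds ρ G)) ∧
    -- `Rep(Aut_R(M)) = ⨁_F Rep(Aut_R(M))_F`: every finite-dimensional representation has a unique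
    -- decomposition into pieces in the strata, and there are no non-zero morphisms between
    -- different strata.
    (∀ {V : Type x} [AddCommGroup V] [Module K V] [FiniteDimensional K V]
      (ρ : Representation K (AutGroup M) V),
        ∃! U : IsoClass (𝔬 ⧸ IsLocalRing.maximalIdeal 𝔬 ^ ℓ) Ms → Subrepresentation ρ,
          (∀ c, InStratumClass c (U c).toRepresentation) ∧ IsDirectSumOf ρ U) ∧
    (∀ {V V' : Type x} [AddCommGroup V] [Module K V] [AddCommGroup V'] [Module K V']
      (ρ : Representation K (AutGroup M) V) (ρ' : Representation K (AutGroup M) V')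
      (c c' : IsoClass (𝔬 ⧸ IsLocalRing.maximalIdeal 𝔬 ^ ℓ) Ms), c ≠ c' →
        InStratumClass c ρ → InStratumClass c' ρ' →
          ∀ f : ρ.IntertwiningMap ρ', f = 0) := by
  refine ⟨fun ρ hρ => ?_, fun ρ hρ F => ?_, fun ρ => existsUnique_decomposition hfin,
    fun ρ ρ' c c' hcc h h' f => intertwiningMap_eq_zero hfin hcc h h' f⟩
  · obtain ⟨F, hF⟩ := exists_isTypical (𝔬 ⧸ IsLocalRing.maximalIdeal 𝔬 ^ ℓ) hfin hρ
    exact ⟨F, hF.isFiniteValued hfin, fun G =>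
      ⟨fun hG => hG.nonempty_iso_of_isTypical hfin hF, fun ⟨e⟩ => hF.of_iso e.symm⟩⟩
  · simp only [isTypical_iff, ← hasHom_iff_embeds hfin hρ, hρ, true_and]
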